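/- Let $A,B$ be complex $n\times n$ matrices which are accretive, i.e. $\Re A=\frac{A+A^*}{2}$ and $\Re B$ are positive definite. For a matrix $X$ let $W(X)=\{\langle Xx,x\rangle : x\in\mathbb{C}^n,\ \|x\|=1\}$ be its numerical range and $w(X)=\max\{|z|:z\in W(X)\}$ its numerical radius. Let $0\le\alpha<\frac{\pi}{2}$ and suppose that $$W(A),\,W(B)\subset S_\alpha:=\{z\in\mathbb{C}:|\Im z|\le \tan\alpha\,\Re z\}.$$ For $0\le t\le 1$ let $$A\sharp_t B=\int_{[0,1]}\bigl((1-s)A^{-1}+sB^{-1}\bigr)^{-1}\,d\nu_t(s)$$ be the weighted geometric mean, where $\nu_t$ is the probability measure on $[0,1]$ with $x^t=\int_{[0,1]}\bigl((1-s)+sx^{-1}\bigr)^{-1}\,d\nu_t(s)$ for all $x>0$ (for $0<t<1$, $d\nu_t(s)=\frac{\sin \pi t}{\pi}\,s^{t-1}(1-s)^{-t}\,ds$ on $(0,1)$; $\nu_0=\delta_0$ and $\nu_1=\delta_1$). Let $$\mathcal{L}(A,B)=\int_0^1 A\sharp_t B\,dt,\qquad \mathcal{L}(a,b)=\int_0^1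 a^{1-t}b^t\,dt\quad(a,b>0)$$ be the logarithmic mean of matrices and of positive numbers. Then the integrals defining $A\sharp_tB$ $(0\le t\le 1)$ and $\mathcal{L}(A,B)$ converge absolutely, and $$w(\mathcal{L}(A,B))\le \sec^3\alpha\;\mathcal{L}(w(A),w(B)).$$ -/

import Mathlib

open scoped Matrix.Norms.L2Operator ComplexOrder

namespace NumRadius

/-- The numerical range `W(A) = {⟨Ax, x⟩ : x ∈ ℂⁿ, ‖x‖ = 1}`. Mathlib's inner product is
conjugate-linear in the first argument, so `⟨Ax, x⟩` is `inner ℂ x (A x)`. -/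
def numericalRange {n : ℕ} (A : Matrix (Fin n) (Fin n) ℂ) : Set ℂ :=
  {z | ∃ x : EuclideanSpace ℂ (Fin n), ‖x‖ = 1 ∧ z = inner ℂ x (Matrix.toEuclideanLin A x)}

/-- The numerical radius `w(A) = max {|z| : z ∈ W(A)}`. -/
noncomputable def numericalRadius {n : ℕ} (A : Matrix (Fin n) (Fin n) ℂ) : ℝ :=
  sSup ((fun z : ℂ => ‖z‖) '' numericalRange A)

/-- `A` is accretive: its real part `(A + A*) / 2` is positive definite. -/
def IsAccretive {n : ℕ} (A : Matrix (Fin n) (Fin n) ℂ) : Prop :=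
  (realPart A : Matrix (Fin n) (Fin n) ℂ).PosDef

/-- The sector `S_α` of the complex plane. -/
def sector (α : ℝ) : Set ℂ := {z | |z.im| ≤ Real.tan α * z.re}

/-- The weighted harmonic mean `A !_s B = ((1 - s) A⁻¹ + s B⁻¹)⁻¹`. -/
noncomputable def harmonicMean {n : ℕ} (s : ℝ) (A B : Matrix (Fin n) (Fin n) ℂ) :
    Matrix (Fin n) (Fin n) ℂ :=
  ((1 - s) • A⁻¹ + s • B⁻¹)⁻¹

/-- `ν` is a probability measure on `[0, 1]` with
`f x = ∫ ((1 - s) + s x⁻¹)⁻¹ dν(s)` for all `x > 0`. -/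
def IsMeanMeasure (f : ℝ → ℝ) (ν : MeasureTheory.Measure ℝ) : Prop :=
  MeasureTheory.IsProbabilityMeasure ν ∧ (∀ᵐ s ∂ν, s ∈ Set.Icc (0 : ℝ) 1) ∧
    ∀ x : ℝ, 0 < x → f x = ∫ s, ((1 - s) + s * x⁻¹)⁻¹ ∂ν

/-- The operator mean `A σ_f B = ∫ (A !_s B) dν(s)`, where `ν` is the measure of `f`. -/
noncomputable def operatorMean {n : ℕ} (ν : MeasureTheory.Measure ℝ)
    (A B : Matrix (Fin n) (Fin n) ℂ) : Matrix (Fin n) (Fin n) ℂ :=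
  ∫ s, harmonicMean s A B ∂ν

/-- The measure of the function `x ↦ x ^ t`, `0 ≤ t ≤ 1`: for `0 < t < 1` it is the
Beta distribution with parameters `t` and `1 - t`, with density
`(sin (π t) / π) s ^ (t - 1) (1 - s) ^ (-t)` on `(0, 1)`. -/
noncomputable def geometricMeasure (t : ℝ) : MeasureTheory.Measure ℝ :=
  if t = 0 then MeasureTheory.Measure.dirac 0
  else if t = 1 then MeasureTheory.Measure.dirac 1
  else ProbabilityTheory.betaMeasure t (1 - t)

theorem integral_betaMeasure (a b : ℝ) (ha : 0 < a) (hb : 0 < b) (g : ℝ → ℝ) :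
    ∫ s, g s ∂(ProbabilityTheory.betaMeasure a b)
      = ∫ s in Set.Ioo (0 : ℝ) 1, ProbabilityTheory.betaPDFReal a b s * g s := by
  have h0 : ∀ s, 0 ≤ ProbabilityTheory.betaPDFReal a b s := by
    intro s
    by_cases h : 0 < s ∧ s < 1
    · exact (ProbabilityTheory.betaPDFReal_pos h.1 h.2 ha hb).le
    · simp [ProbabilityTheory.betaPDFReal, h]
  unfold ProbabilityTheory.betaMeasure
  rw [integral_withDensity_eq_integral_toReal_smul
    (by unfold ProbabilityTheory.betaPDF; fun_prop)
    (Filter.Eventually.of_forall fun s => by simp [ProbabilityTheory.betaPDF])]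
  rw [MeasureTheory.setIntegral_eq_integral_of_forall_compl_eq_zero]
  · refine MeasureTheory.integral_congr_ae (Filter.Eventually.of_forall fun s => ?_)
    simp [ProbabilityTheory.betaPDF, ENNReal.toReal_ofReal (h0 s)]
  · intro s hs
    have : ¬ (0 < s ∧ s < 1) := hs
    simp [ProbabilityTheory.betaPDFReal, this]

theorem rpow_eq_integral_beta (t : ℝ) (ht0 : 0 < t) (ht1 : t < 1) (x : ℝ) (hx : 0 < x) :
    x ^ t = ∫ s, ((1 - s) + s * x⁻¹)⁻¹ ∂(ProbabilityTheory.betaMeasure t (1 - t)) := by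
  have hb : 0 < 1 - t := by linarith
  have := ProbabilityTheory.isProbabilityMeasureBeta ht0 hb
  have hone : ∫ s in Set.Ioo (0 : ℝ) 1, ProbabilityTheory.betaPDFReal t (1 - t) s = 1 := by
    have := integral_betaMeasure t (1 - t) ht0 hb (fun _ => 1)
    simpa using this.symm
  have hD : ∀ s ∈ Set.Ioo (0 : ℝ) 1, 0 < (1 - s) + s * x⁻¹ := by
    intro s hs
    have := hs.1; have := hs.2
    have : 0 < s * x⁻¹ := by positivity
    linarith
  set φ : ℝ → ℝ := fun s => s * x⁻¹ / ((1 - s) + s * x⁻¹) with hφ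
  have hone_sub : ∀ s ∈ Set.Ioo (0 : ℝ) 1, 1 - φ s = (1 - s) / ((1 - s) + s * x⁻¹) := by
    intro s hs
    have := (hD s hs).ne'
    simp only [hφ]
    rw [eq_div_iff this, sub_mul, div_mul_cancel₀ _ this]
    ring
  have hφmem : ∀ s ∈ Set.Ioo (0 : ℝ) 1, φ s ∈ Set.Ioo (0 : ℝ) 1 := by
    intro s hs
    have h1 := hs.1
    have h2 : 0 < 1 - s := by linarith [hs.2]
    have h3 := hD s hs
    refine ⟨by simp only [hφ]; positivity, ?_⟩
    have : 0 < 1 - φ s := by rw [hone_sub s hs]; positivity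
    linarith
  have himg : φ '' Set.Ioo (0 : ℝ) 1 = Set.Ioo (0 : ℝ) 1 := by
    apply Set.Subset.antisymm
    · rintro _ ⟨s, hs, rfl⟩
      exact hφmem s hs
    · intro u hu
      have h1 := hu.1
      have h2 : 0 < 1 - u := by linarith [hu.2]
      have h3 : 0 < (1 - u) + u * x := by positivity
      refine ⟨u * x / ((1 - u) + u * x), ⟨by positivity, ?_⟩, ?_⟩
      · rw [div_lt_one h3]; linarith
      · simp only [hφ]
        have e : 1 - u * x / ((1 - u) + u * x) = (1 - u) / ((1 - u) + u * x) := by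
          rw [eq_div_iff h3.ne', sub_mul, div_mul_cancel₀ _ h3.ne']; ring
        have e2 : u * x / ((1 - u) + u * x) * x⁻¹ = u / ((1 - u) + u * x) := by
          field_simp
        rw [e, e2, ← add_div, div_div_div_cancel_right₀ h3.ne']
        simp
  have hder : ∀ s ∈ Set.Ioo (0 : ℝ) 1, HasDerivWithinAt φ
      (x⁻¹ / ((1 - s) + s * x⁻¹) ^ 2) (Set.Ioo (0 : ℝ) 1) s := by
    intro s hs
    have h1 : HasDerivAt (fun s : ℝ => s * x⁻¹) x⁻¹ s := by
      simpa using (hasDerivAt_id s).mul_const x⁻¹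
    have h2 : HasDerivAt (fun s : ℝ => (1 - s) + s * x⁻¹) (-1 + x⁻¹) s := by
      exact ((hasDerivAt_id s).const_sub 1).add h1
    have h3 := (h1.div h2 (hD s hs).ne').hasDerivWithinAt (s := Set.Ioo (0 : ℝ) 1)
    refine h3.congr_deriv ?_
    congr 1
    ring
  have hinj : Set.InjOn φ (Set.Ioo (0 : ℝ) 1) := by
    intro s hs r hr h
    have h3 := (hD s hs).ne'
    have h4 := (hD r hr).ne'
    simp only [hφ] at h
    rw [div_eq_div_iff h3 h4] at h
    have hx' : x⁻¹ ≠ 0 := (inv_pos.2 hx).ne'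
    have : x⁻¹ * (s - r) = 0 := by linarith
    rcases mul_eq_zero.1 this with h5 | h5
    · exact absurd h5 hx'
    · linarith
  have key := MeasureTheory.integral_image_eq_integral_abs_deriv_smul
    (measurableSet_Ioo : MeasurableSet (Set.Ioo (0 : ℝ) 1)) hder hinj
    (ProbabilityTheory.betaPDFReal t (1 - t))
  rw [himg, hone] at key
  rw [integral_betaMeasure t (1 - t) ht0 hb]
  have hstart : x ^ t = x ^ t * ∫ s in Set.Ioo (0 : ℝ) 1, |x⁻¹ / ((1 - s) + s * x⁻¹) ^ 2| •
      ProbabilityTheory.betaPDFReal t (1 - t) (φ s) := by rw [← key, mul_one]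
  rw [hstart, ← MeasureTheory.integral_const_mul]
  refine MeasureTheory.setIntegral_congr_fun measurableSet_Ioo fun s hs => ?_
  have h1 := hs.1
  have h2 : 0 < 1 - s := by linarith [hs.2]
  have h3 := hD s hs
  have hm := hφmem s hs
  have e1 : ProbabilityTheory.betaPDFReal t (1 - t) (φ s)
      = 1 / ProbabilityTheory.beta t (1 - t) * φ s ^ (t - 1) * (1 - φ s) ^ (1 - t - 1) :=
    if_pos hm
  have e2 : ProbabilityTheory.betaPDFReal t (1 - t) s
      = 1 / ProbabilityTheory.beta t (1 - t) * s ^ (t - 1) * (1 - s) ^ (1 - t - 1) :=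
    if_pos hs
  simp only [smul_eq_mul]
  rw [e1, e2, hone_sub s hs]
  simp only [hφ]
  set D := (1 - s) + s * x⁻¹ with hDdef
  rw [abs_of_pos (by positivity), Real.div_rpow (by positivity) h3.le,
    Real.div_rpow h2.le h3.le, Real.mul_rpow h1.le (by positivity),
    Real.inv_rpow hx.le]
  have f1 : x ^ (t - 1) = x ^ t / x := by rw [Real.rpow_sub hx, Real.rpow_one]
  have f2 : D ^ (t - 1) = D ^ t / D := by rw [Real.rpow_sub h3, Real.rpow_one]
  have f3 : D ^ (1 - t - 1) = (D ^ t)⁻¹ := by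
    rw [← Real.rpow_neg h3.le]; congr 1; ring
  rw [f1, f2, f3]
  have g1 : x ^ t ≠ 0 := (Real.rpow_pos_of_pos hx t).ne'
  have g2 : D ^ t ≠ 0 := (Real.rpow_pos_of_pos h3 t).ne'
  have g3 := h3.ne'
  have g4 := hx.ne'
  clear_value D
  field_simp

/-- `geometricMeasure t` is the measure belonging to `x ↦ x ^ t`. -/
theorem isMeanMeasure_geometricMeasure (t : ℝ) (ht : t ∈ Set.Icc (0 : ℝ) 1) :
    IsMeanMeasure (fun x => x ^ t) (geometricMeasure t) := by
  unfold geometricMeasure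
  split_ifs with h0 h1
  · subst h0
    refine ⟨inferInstance, ?_, fun x hx => by simp⟩
    rw [MeasureTheory.ae_dirac_eq]
    simp
  · subst h1
    refine ⟨inferInstance, ?_, fun x hx => by simp⟩
    rw [MeasureTheory.ae_dirac_eq]
    simp
  · have ht0 : 0 < t := lt_of_le_of_ne ht.1 (Ne.symm h0)
    have ht1 : t < 1 := lt_of_le_of_ne ht.2 h1
    refine ⟨ProbabilityTheory.isProbabilityMeasureBeta ht0 (by linarith), ?_,
      fun x hx => rpow_eq_integral_beta t ht0 ht1 x hx⟩
    unfold ProbabilityTheory.betaMeasure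
    rw [MeasureTheory.ae_withDensity_iff (by unfold ProbabilityTheory.betaPDF; fun_prop)]
    refine Filter.Eventually.of_forall fun s hs => ?_
    by_contra hc
    apply hs
    have : ¬ (0 < s ∧ s < 1) := fun h => hc ⟨h.1.le, h.2.le⟩
    simp [ProbabilityTheory.betaPDF_eq, this]

/-- The weighted geometric mean `A ♯_t B`, i.e. the operator mean of `x ↦ x ^ t`. -/
noncomputable def geometricMean {n : ℕ} (t : ℝ) (A B : Matrix (Fin n) (Fin n) ℂ) :
    Matrix (Fin n) (Fin n) ℂ :=
  operatorMean (geometricMeasure t) A B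

/-- The logarithmic mean `𝓛(A, B) = ∫₀¹ A ♯_t B dt` of accretive matrices. -/
noncomputable def logarithmicMean {n : ℕ} (A B : Matrix (Fin n) (Fin n) ℂ) :
    Matrix (Fin n) (Fin n) ℂ :=
  ∫ t in (0 : ℝ)..1, geometricMean t A B

/-- The logarithmic mean `∫₀¹ a ^ (1 - t) b ^ t dt` of positive numbers. -/
noncomputable def scalarLogarithmicMean (a b : ℝ) : ℝ :=
  ∫ t in (0 : ℝ)..1, a ^ (1 - t) * b ^ t

end NumRadius

/-! The core is a lower bound for the inverse of a sectorial matrix. Write `A = R + iS` with `R`,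
`S` Hermitian and `τ = tan α`, so that `|S| ≤ τR` as forms and `R ≤ w(A)`. Then `A*A ≤ w(A)(1 +
τ²)R`, and evaluating at `A⁻¹y` gives `Re A⁻¹ ≥ cos²α / w(A)` (`norm_sq_le_re_inner_inv`).

This bound is linear in the inverse, so `C = (1-s)A⁻¹ + sB⁻¹` satisfies `Re C ≥ c cos²α` with `c =
(1-s)/w(A) + s/w(B)`. Cauchy–Schwarz turns it into `Re C⁻¹ ≤ sec²α / c`. The form of `C⁻¹` also lies
in the sector, so passing from real part to modulus costs a third `sec α`
(`norm_inner_harmonicMean_le`).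

Here `1/c` is the scalar harmonic mean of `w(A)` and `w(B)`. Integrating over `ν_t` yields
`w(A)^(1-t) w(B)^t`, and integrating over `t` yields the scalar logarithmic mean. Integrability in
`s` follows from continuity on `[0,1]`; in `t`, from a uniform bound and joint continuity of the
beta density. -/

namespace NumRadius

/-! ### Form inequalities for sectorial operators -/

section Operator

variable {E : Type*} [NormedAddCommGroup E] [InnerProductSpace ℂ E]

/-- Expansion of the quadratic form of a symmetric operator along a real line. -/
theorem re_inner_add_real_smul {R : E →ₗ[ℂ] E} (hR : R.IsSymmetric) (c : ℝ) (x y : E) :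
    (inner ℂ (x + (c : ℂ) • y) (R (x + (c : ℂ) • y))).re =
      (inner ℂ x (R x)).re + 2 * c * (inner ℂ y (R x)).re + c ^ 2 * (inner ℂ y (R y)).re := by
  have h : (inner ℂ x (R y)).re = (inner ℂ y (R x)).re := by
    rw [← hR x y, ← inner_conj_symm, Complex.conj_re]
  simp only [map_add, map_smul, inner_add_left, inner_add_right, inner_smul_left,
    inner_smul_right, Complex.conj_ofReal, Complex.add_re, Complex.re_ofReal_mul, h]
  ring

/-- A nonnegative symmetric operator bounded by `a` satisfies `R² ≤ a R`. -/
theorem norm_sq_apply_le_of_symmetric {R : E →ₗ[ℂ] E} (hR : R.IsSymmetric)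
    (hpos : ∀ x, 0 ≤ (inner ℂ x (R x)).re) {a : ℝ} (ha0 : 0 < a)
    (ha : ∀ x, (inner ℂ x (R x)).re ≤ a * ‖x‖ ^ 2) (u : E) :
    ‖R u‖ ^ 2 ≤ a * (inner ℂ u (R u)).re := by
  -- Expands to `⟨u,Ru⟩ - 2a⁻¹‖Ru‖² + a⁻²⟨Ru,R(Ru)⟩ ≥ 0`; the last term is at most `a⁻¹‖Ru‖²`.
  have h0 := hpos (u + ((-a⁻¹ : ℝ) : ℂ) • R u)
  have h1 : (inner ℂ (R u) (R u)).re = ‖R u‖ ^ 2 := inner_self_eq_norm_sq (𝕜 := ℂ) (R u)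
  rw [re_inner_add_real_smul hR, h1] at h0
  have h2 := mul_le_mul_of_nonneg_left (ha (R u)) (sq_nonneg (-a⁻¹))
  have h3 : (-a⁻¹) ^ 2 * (a * ‖R u‖ ^ 2) = a⁻¹ * ‖R u‖ ^ 2 := by field_simp
  have h4 : a⁻¹ * ‖R u‖ ^ 2 ≤ (inner ℂ u (R u)).re := by linarith
  calc ‖R u‖ ^ 2 = a * (a⁻¹ * ‖R u‖ ^ 2) := by field_simp
    _ ≤ _ := mul_le_mul_of_nonneg_left h4 ha0.le

/-- This is `S R⁻¹ S ≤ τ²R`, with `w` playing the role of `R⁻¹Sz`. Subtracting the forms of `S` at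
`z + cw` and `z - cw` isolates `4c⟨w,Sz⟩ = 4c⟨w,Rw⟩`, while the parallelogram law adds up the
right-hand sides. The choice `c = 1/τ` gives the constant; for `τ = 0`, any positive `c` does. -/
theorem re_inner_le_of_abs_le {R S : E →ₗ[ℂ] E} (hR : R.IsSymmetric) (hS : S.IsSymmetric)
    {τ : ℝ} (hτ0 : 0 ≤ τ)
    (hτ : ∀ x, |(inner ℂ x (S x)).re| ≤ τ * (inner ℂ x (R x)).re) {z w : E} (hw : R w = S z) :
    (inner ℂ w (R w)).re ≤ τ ^ 2 * (inner ℂ z (R z)).re := by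
  have key : ∀ c : ℝ, 4 * c * (inner ℂ w (R w)).re ≤
      τ * (2 * (inner ℂ z (R z)).re + 2 * c ^ 2 * (inner ℂ w (R w)).re) := by
    intro c
    have h1 := (le_abs_self _).trans (hτ (z + (c : ℂ) • w))
    have h2 := (neg_le_abs _).trans (hτ (z + ((-c : ℝ) : ℂ) • w))
    rw [re_inner_add_real_smul hR, re_inner_add_real_smul hS, ← hw] at h1 h2
    nlinarith
  rcases hτ0.eq_or_lt with h | h
  · have := key 1
    rw [← h] at this ⊢
    linarith
  · have h1 := mul_le_mul_of_nonneg_left (key τ⁻¹) hτ0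
    have e1 : τ * (4 * τ⁻¹ * (inner ℂ w (R w)).re) = 4 * (inner ℂ w (R w)).re := by field_simp
    have e2 : τ * (τ * (2 * (inner ℂ z (R z)).re + 2 * τ⁻¹ ^ 2 * (inner ℂ w (R w)).re)) =
        2 * (τ ^ 2 * (inner ℂ z (R z)).re) + 2 * (inner ℂ w (R w)).re := by field_simp
    linarith

/-- If `|S| ≤ τ R ≤ τ a` in the form sense, then `T = R + i S` satisfies
`T* T ≤ a (1 + τ²) R`. -/
theorem norm_sq_add_I_smul_le [FiniteDimensional ℂ E] {R S : E →ₗ[ℂ] E}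
    (hR : R.IsSymmetric) (hS : S.IsSymmetric)
    (hpos : ∀ x, x ≠ 0 → 0 < (inner ℂ x (R x)).re) {τ : ℝ} (hτ0 : 0 ≤ τ)
    (hτ : ∀ x, |(inner ℂ x (S x)).re| ≤ τ * (inner ℂ x (R x)).re) {a : ℝ} (ha0 : 0 < a)
    (ha : ∀ x, (inner ℂ x (R x)).re ≤ a * ‖x‖ ^ 2) (z : E) :
    ‖R z + Complex.I • S z‖ ^ 2 ≤ a * (1 + τ ^ 2) * (inner ℂ z (R z)).re := by
  have hinj : Function.Injective R := by
    refine (injective_iff_map_eq_zero R).2 fun x hx => ?_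
    by_contra h
    have := hpos x h
    simp [hx] at this
  -- With `w = R⁻¹Sz` one has `Rz + iSz = R(z + iw)`, so the bound `R² ≤ aR` applies at `z + iw`.
  obtain ⟨w, hw⟩ := (LinearMap.injective_iff_surjective.1 hinj) (S z)
  have hnonneg : ∀ x, 0 ≤ (inner ℂ x (R x)).re := by
    intro x
    rcases eq_or_ne x 0 with rfl | h
    · simp
    · exact (hpos x h).le
  have h1 := norm_sq_apply_le_of_symmetric hR hnonneg ha0 ha (z + Complex.I • w)
  have him : (inner ℂ z (S z)).im = 0 := hS.im_inner_self_apply z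
  -- The cross terms are `±i⟨z,Sz⟩` with `⟨z,Sz⟩` real, so they drop out of the real part.
  have hre : (inner ℂ (z + Complex.I • w) (R (z + Complex.I • w))).re =
      (inner ℂ z (R z)).re + (inner ℂ w (R w)).re := by
    have e1 : inner ℂ w (R z) = inner ℂ (S z) z := by rw [← hR w z, hw]
    have e2 : (inner ℂ (S z) z : ℂ).im = 0 := by rw [hS z z]; exact him
    simp only [map_add, map_smul, inner_add_left, inner_add_right, inner_smul_left,
      inner_smul_right, e1]
    rw [hw]
    simp [him, e2]
  rw [hre, map_add, map_smul, hw] at h1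
  have h2 := re_inner_le_of_abs_le hR hS hτ0 hτ hw
  rw [hw] at h2
  nlinarith

/-- For a sectorial operator `T` whose real part is bounded by `a`,
`T* T ≤ a (1 + τ²) Re T`. -/
theorem norm_sq_apply_le_of_sectorial [FiniteDimensional ℂ E] {T : E →ₗ[ℂ] E}
    (hpos : ∀ x, x ≠ 0 → 0 < (inner ℂ x (T x)).re) {τ : ℝ} (hτ0 : 0 ≤ τ)
    (hτ : ∀ x, |(inner ℂ x (T x)).im| ≤ τ * (inner ℂ x (T x)).re) {a : ℝ} (ha0 : 0 < a)
    (ha : ∀ x, (inner ℂ x (T x)).re ≤ a * ‖x‖ ^ 2) (z : E) :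
    ‖T z‖ ^ 2 ≤ a * (1 + τ ^ 2) * (inner ℂ z (T z)).re := by
  set R : E →ₗ[ℂ] E := (2⁻¹ : ℂ) • (T + LinearMap.adjoint T) with hRdef
  set S : E →ₗ[ℂ] E := (-(Complex.I * 2⁻¹)) • (T - LinearMap.adjoint T) with hSdef
  have hR : R.IsSymmetric := by
    intro x y
    simp [hRdef, inner_smul_left, inner_smul_right, inner_add_left, inner_add_right,
      LinearMap.adjoint_inner_left, LinearMap.adjoint_inner_right, map_ofNat]
    ring
  have hS : S.IsSymmetric := by
    intro x y
    simp [hSdef, inner_smul_left, inner_smul_right, inner_sub_left, inner_sub_right,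
      LinearMap.adjoint_inner_left, LinearMap.adjoint_inner_right, map_ofNat]
    ring
  have hre : ∀ x, (inner ℂ (T x) x).re = (inner ℂ x (T x)).re := fun x => by
    rw [← inner_conj_symm, Complex.conj_re]
  have him : ∀ x, (inner ℂ (T x) x).im = -(inner ℂ x (T x)).im := fun x => by
    rw [← inner_conj_symm, Complex.conj_im]
  have hRre : ∀ x, (inner ℂ x (R x)).re = (inner ℂ x (T x)).re := by
    intro x
    simp [hRdef, LinearMap.adjoint_inner_right, hre]
    ring
  have hSre : ∀ x, (inner ℂ x (S x)).re = (inner ℂ x (T x)).im := by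
    intro x
    simp [hSdef, inner_smul_right, inner_sub_right, LinearMap.adjoint_inner_right, him]
    ring
  have hT : R z + Complex.I • S z = T z := by
    have : Complex.I * (-(Complex.I * 2⁻¹)) = 2⁻¹ := by
      linear_combination (-2⁻¹ : ℂ) * Complex.I_mul_I
    simp only [hRdef, hSdef, LinearMap.smul_apply, LinearMap.add_apply, LinearMap.sub_apply,
      smul_smul, this]
    module
  have := norm_sq_add_I_smul_le hR hS (fun x hx => by rw [hRre]; exact hpos x hx) hτ0
    (fun x => by rw [hSre, hRre]; exact hτ x) ha0 (fun x => by rw [hRre]; exact ha x) z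
  rwa [hT, hRre] at this

end Operator

/-! ### Numerical range and numerical radius -/

section NumericalRange

variable {n : ℕ}

theorem toEuclideanLin_real_smul (c : ℝ) (M : Matrix (Fin n) (Fin n) ℂ) :
    Matrix.toEuclideanLin (c • M) = (c : ℂ) • Matrix.toEuclideanLin M := by
  rw [← map_smul, Complex.coe_smul]

theorem toEuclideanLin_inv_apply {M : Matrix (Fin n) (Fin n) ℂ} (hM : IsUnit M)
    (x : EuclideanSpace ℂ (Fin n)) :
    Matrix.toEuclideanLin M (Matrix.toEuclideanLin M⁻¹ x) = x := by
  rw [Matrix.toLpLin_apply, Matrix.toLpLin_apply, Matrix.mulVec_mulVec,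
    Matrix.mul_nonsing_inv _ ((Matrix.isUnit_iff_isUnit_det M).1 hM)]
  simp

theorem IsAccretive.re_inner_pos {A : Matrix (Fin n) (Fin n) ℂ} (hA : IsAccretive A)
    {x : EuclideanSpace ℂ (Fin n)} (hx : x ≠ 0) :
    0 < (inner ℂ x (Matrix.toEuclideanLin A x)).re := by
  have h := Matrix.PosDef.re_dotProduct_pos hA (x := x.ofLp) (by simpa using hx)
  have e : star x.ofLp ⬝ᵥ (realPart A : Matrix (Fin n) (Fin n) ℂ).mulVec x.ofLp =
      inner ℂ x (Matrix.toEuclideanLin (realPart A : Matrix (Fin n) (Fin n) ℂ) x) := by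
    rw [EuclideanSpace.inner_eq_star_dotProduct, dotProduct_comm]
    rfl
  rw [e, realPart_apply_coe, toEuclideanLin_real_smul, map_add, Matrix.star_eq_conjTranspose,
    Matrix.toEuclideanLin_conjTranspose_eq_adjoint] at h
  simp only [LinearMap.smul_apply, LinearMap.add_apply, inner_smul_right, inner_add_right,
    LinearMap.adjoint_inner_right] at h
  rw [← inner_conj_symm (Matrix.toEuclideanLin A x) x] at h
  simp only [RCLike.re_to_complex, Complex.re_ofReal_mul, Complex.add_re, Complex.conj_re] at h
  linarith

theorem isUnit_of_re_inner_pos {M : Matrix (Fin n) (Fin n) ℂ}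
    (h : ∀ x : EuclideanSpace ℂ (Fin n), x ≠ 0 →
      0 < (inner ℂ x (Matrix.toEuclideanLin M x)).re) : IsUnit M := by
  rw [← Matrix.mulVec_injective_iff_isUnit]
  refine (injective_iff_map_eq_zero (Matrix.mulVecLin M)).2 fun x hx => ?_
  by_contra hne
  have := h (WithLp.toLp 2 x) (by simpa using hne)
  rw [Matrix.mulVecLin_apply] at hx
  simp [hx] at this

theorem exists_mem_numericalRange (A : Matrix (Fin n) (Fin n) ℂ)
    {x : EuclideanSpace ℂ (Fin n)} (hx : x ≠ 0) :
    ∃ z ∈ numericalRange A,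
      inner ℂ x (Matrix.toEuclideanLin A x) = ((‖x‖ ^ 2 : ℝ) : ℂ) * z := by
  have hn : (‖x‖ : ℂ) ≠ 0 := by simpa using hx
  refine ⟨_, ⟨((‖x‖⁻¹ : ℝ) : ℂ) • x, ?_, rfl⟩, ?_⟩
  · rw [norm_smul, Complex.norm_real, norm_inv, norm_norm, inv_mul_cancel₀ (by simpa using hx)]
  · simp only [map_smul, inner_smul_left, inner_smul_right, Complex.conj_ofReal]
    push_cast
    field_simp

theorem abs_im_inner_le {A : Matrix (Fin n) (Fin n) ℂ} {α : ℝ}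
    (hA : numericalRange A ⊆ sector α) (x : EuclideanSpace ℂ (Fin n)) :
    |(inner ℂ x (Matrix.toEuclideanLin A x)).im| ≤
      Real.tan α * (inner ℂ x (Matrix.toEuclideanLin A x)).re := by
  rcases eq_or_ne x 0 with rfl | hx
  · simp
  obtain ⟨z, hz, h⟩ := exists_mem_numericalRange A hx
  have h1 : |z.im| ≤ Real.tan α * z.re := hA hz
  rw [h, Complex.im_ofReal_mul, Complex.re_ofReal_mul, abs_mul, abs_of_nonneg (sq_nonneg _)]
  nlinarith [sq_nonneg ‖x‖]

theorem bddAbove_norm_numericalRange (A : Matrix (Fin n) (Fin n) ℂ) :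
    BddAbove ((fun z : ℂ => ‖z‖) '' numericalRange A) := by
  refine ⟨‖LinearMap.toContinuousLinearMap (Matrix.toEuclideanLin A)‖, ?_⟩
  rintro _ ⟨_, ⟨x, hx, rfl⟩, rfl⟩
  have h1 := norm_inner_le_norm (𝕜 := ℂ) x (Matrix.toEuclideanLin A x)
  have h2 := (LinearMap.toContinuousLinearMap (Matrix.toEuclideanLin A)).le_opNorm x
  rw [hx, one_mul] at h1
  rw [hx, mul_one] at h2
  exact h1.trans h2

theorem norm_inner_le_numericalRadius (A : Matrix (Fin n) (Fin n) ℂ)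
    (x : EuclideanSpace ℂ (Fin n)) :
    ‖inner ℂ x (Matrix.toEuclideanLin A x)‖ ≤ numericalRadius A * ‖x‖ ^ 2 := by
  rcases eq_or_ne x 0 with rfl | hx
  · simp
  obtain ⟨z, hz, h⟩ := exists_mem_numericalRange A hx
  have h1 : ‖z‖ ≤ numericalRadius A :=
    le_csSup (bddAbove_norm_numericalRange A) ⟨z, hz, rfl⟩
  rw [h, norm_mul, Complex.norm_real, Real.norm_of_nonneg (sq_nonneg _), mul_comm]
  exact mul_le_mul_of_nonneg_right h1 (sq_nonneg _)

/-- Nonnegativity of `c` covers `n = 0`, where the numerical range is empty and `sSup ∅ = 0`. -/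
theorem numericalRadius_le {A : Matrix (Fin n) (Fin n) ℂ} {c : ℝ} (hc : 0 ≤ c)
    (h : ∀ x : EuclideanSpace ℂ (Fin n), ‖x‖ = 1 →
      ‖inner ℂ x (Matrix.toEuclideanLin A x)‖ ≤ c) : numericalRadius A ≤ c := by
  refine Real.sSup_le ?_ hc
  rintro _ ⟨_, ⟨x, hx, rfl⟩, rfl⟩
  exact h x hx

theorem IsAccretive.numericalRadius_pos [NeZero n] {A : Matrix (Fin n) (Fin n) ℂ}
    (hA : IsAccretive A) : 0 < numericalRadius A := by
  obtain ⟨x, hx⟩ := exists_ne (0 : EuclideanSpace ℂ (Fin n))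
  have h1 := hA.re_inner_pos hx
  have h2 := norm_inner_le_numericalRadius A x
  have h3 := Complex.re_le_norm (inner ℂ x (Matrix.toEuclideanLin A x))
  exact pos_of_mul_pos_left (h1.trans_le (h3.trans h2)) (sq_nonneg _)

theorem norm_le_sec_mul_re {α : ℝ} (hα : 0 < Real.cos α) {z : ℂ}
    (hre : 0 ≤ z.re) (hz : |z.im| ≤ Real.tan α * z.re) : ‖z‖ ≤ 1 / Real.cos α * z.re := by
  refine abs_le_of_sq_le_sq' ?_ (by positivity) |>.2
  have h1 : z.im ^ 2 ≤ (Real.tan α * z.re) ^ 2 := sq_le_sq' (abs_le.1 hz).1 (abs_le.1 hz).2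
  have h2 : 1 + Real.tan α ^ 2 = (1 / Real.cos α) ^ 2 := by
    rw [one_div, inv_pow, ← Real.inv_one_add_tan_sq hα.ne', inv_inv]
  rw [← Complex.normSq_eq_norm_sq, Complex.normSq_apply, mul_pow, ← h2]
  nlinarith

end NumericalRange

/-! ### Inverses and the weighted harmonic mean -/

section HarmonicMean

variable {n : ℕ}

/-- Substituting `x = A⁻¹y` lets positivity and the symmetric sector condition pass from `A` to
`A⁻¹`. -/
theorem inner_inv_eq_conj {A : Matrix (Fin n) (Fin n) ℂ} (hA : IsUnit A)
    (y : EuclideanSpace ℂ (Fin n)) :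
    inner ℂ y (Matrix.toEuclideanLin A⁻¹ y) = (starRingEnd ℂ)
      (inner ℂ (Matrix.toEuclideanLin A⁻¹ y)
        (Matrix.toEuclideanLin A (Matrix.toEuclideanLin A⁻¹ y))) := by
  rw [toEuclideanLin_inv_apply hA, inner_conj_symm]

theorem IsAccretive.isUnit {A : Matrix (Fin n) (Fin n) ℂ} (hA : IsAccretive A) : IsUnit A :=
  isUnit_of_re_inner_pos fun _ hx => hA.re_inner_pos hx

theorem IsAccretive.re_inner_inv_pos {A : Matrix (Fin n) (Fin n) ℂ} (hA : IsAccretive A)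
    {y : EuclideanSpace ℂ (Fin n)} (hy : y ≠ 0) :
    0 < (inner ℂ y (Matrix.toEuclideanLin A⁻¹ y)).re := by
  rw [inner_inv_eq_conj hA.isUnit, Complex.conj_re]
  refine hA.re_inner_pos fun h => hy ?_
  rw [← toEuclideanLin_inv_apply hA.isUnit y, h, map_zero]

theorem abs_im_inner_inv_le {A : Matrix (Fin n) (Fin n) ℂ} (hA : IsAccretive A) {α : ℝ}
    (hAα : numericalRange A ⊆ sector α) (y : EuclideanSpace ℂ (Fin n)) :
    |(inner ℂ y (Matrix.toEuclideanLin A⁻¹ y)).im| ≤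
      Real.tan α * (inner ℂ y (Matrix.toEuclideanLin A⁻¹ y)).re := by
  rw [inner_inv_eq_conj hA.isUnit, Complex.conj_re, Complex.conj_im, abs_neg]
  exact abs_im_inner_le hAα _

theorem norm_sq_le_re_inner_inv [NeZero n] {A : Matrix (Fin n) (Fin n) ℂ}
    (hA : IsAccretive A) {α : ℝ} (hα0 : 0 ≤ α) (hα1 : α < Real.pi / 2)
    (hAα : numericalRange A ⊆ sector α) (y : EuclideanSpace ℂ (Fin n)) :
    (numericalRadius A)⁻¹ * ‖y‖ ^ 2 ≤
      (1 / Real.cos α) ^ 2 * (inner ℂ y (Matrix.toEuclideanLin A⁻¹ y)).re := by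
  have hcos : 0 < Real.cos α := Real.cos_pos_of_mem_Ioo ⟨by linarith [Real.pi_pos], hα1⟩
  have h := norm_sq_apply_le_of_sectorial (fun x hx => hA.re_inner_pos hx)
    (Real.tan_nonneg_of_nonneg_of_le_pi_div_two hα0 hα1.le) (abs_im_inner_le hAα)
    hA.numericalRadius_pos
    (fun x => (Complex.re_le_norm _).trans (norm_inner_le_numericalRadius A x))
    (Matrix.toEuclideanLin A⁻¹ y)
  rw [inner_inv_eq_conj hA.isUnit, Complex.conj_re, one_div, inv_pow,
    ← Real.inv_one_add_tan_sq hcos.ne', inv_inv, inv_mul_le_iff₀ hA.numericalRadius_pos,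
    ← mul_assoc]
  rwa [toEuclideanLin_inv_apply hA.isUnit] at h ⊢

theorem inner_weighted_inv (A B : Matrix (Fin n) (Fin n) ℂ) (s : ℝ)
    (y : EuclideanSpace ℂ (Fin n)) :
    inner ℂ y (Matrix.toEuclideanLin ((1 - s) • A⁻¹ + s • B⁻¹) y) =
      ((1 - s : ℝ) : ℂ) * inner ℂ y (Matrix.toEuclideanLin A⁻¹ y) +
        (s : ℂ) * inner ℂ y (Matrix.toEuclideanLin B⁻¹ y) := by
  rw [map_add, toEuclideanLin_real_smul, toEuclideanLin_real_smul]
  simp only [LinearMap.add_apply, LinearMap.smul_apply, inner_add_right, inner_smul_right]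

theorem isUnit_weighted_inv {A B : Matrix (Fin n) (Fin n) ℂ} (hA : IsAccretive A)
    (hB : IsAccretive B) {s : ℝ} (hs : s ∈ Set.Icc (0 : ℝ) 1) :
    IsUnit ((1 - s) • A⁻¹ + s • B⁻¹) := by
  refine isUnit_of_re_inner_pos fun x hx => ?_
  rw [inner_weighted_inv, Complex.add_re, Complex.re_ofReal_mul, Complex.re_ofReal_mul]
  have h1 := hA.re_inner_inv_pos hx
  have h2 := hB.re_inner_inv_pos hx
  rcases hs.1.eq_or_lt with rfl | h
  · simpa using h1
  · have : 0 ≤ 1 - s := by linarith [hs.2]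
    positivity

theorem continuousOn_harmonicMean {A B : Matrix (Fin n) (Fin n) ℂ} (hA : IsAccretive A)
    (hB : IsAccretive B) : ContinuousOn (fun s => harmonicMean s A B) (Set.Icc 0 1) := by
  intro s hs
  refine ContinuousAt.continuousWithinAt ?_
  obtain ⟨u, hu⟩ := isUnit_weighted_inv hA hB hs
  have h1 := NormedRing.inverse_continuousAt u
  rw [hu] at h1
  simp only [harmonicMean, Matrix.nonsing_inv_eq_ringInverse] at *
  exact ContinuousAt.comp (f := fun s : ℝ => (1 - s) • Ring.inverse A + s • Ring.inverse B)
    h1 (by fun_prop)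

/-- Two factors `sec α` come from the lower bound on `Re C`, the third from replacing a real part by
a modulus in the sector. -/
theorem norm_inner_harmonicMean_le [NeZero n] {A B : Matrix (Fin n) (Fin n) ℂ}
    (hA : IsAccretive A) (hB : IsAccretive B) {α : ℝ} (hα0 : 0 ≤ α) (hα1 : α < Real.pi / 2)
    (hAα : numericalRange A ⊆ sector α) (hBα : numericalRange B ⊆ sector α)
    {s : ℝ} (hs : s ∈ Set.Icc (0 : ℝ) 1) (x : EuclideanSpace ℂ (Fin n)) :
    ‖inner ℂ x (Matrix.toEuclideanLin (harmonicMean s A B) x)‖ ≤ (1 / Real.cos α) ^ 3 *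
      ((1 - s) * (numericalRadius A)⁻¹ + s * (numericalRadius B)⁻¹)⁻¹ * ‖x‖ ^ 2 := by
  have hcos : 0 < Real.cos α := Real.cos_pos_of_mem_Ioo ⟨by linarith [Real.pi_pos], hα1⟩
  have ha := hA.numericalRadius_pos
  have hb := hB.numericalRadius_pos
  have hs1 : 0 ≤ 1 - s := by linarith [hs.2]
  set C := (1 - s) • A⁻¹ + s • B⁻¹ with hC
  have hCu : IsUnit C := isUnit_weighted_inv hA hB hs
  change ‖inner ℂ x (Matrix.toEuclideanLin C⁻¹ x)‖ ≤ _
  -- Since `Cy = x`, the form of `C⁻¹` at `x` is the conjugate of the form of `C` at `y`.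
  set y := Matrix.toEuclideanLin C⁻¹ x with hy
  have hx : Matrix.toEuclideanLin C y = x := toEuclideanLin_inv_apply hCu x
  rw [← norm_inner_symm]
  have hyx : inner ℂ y x = ((1 - s : ℝ) : ℂ) * inner ℂ y (Matrix.toEuclideanLin A⁻¹ y) +
        (s : ℂ) * inner ℂ y (Matrix.toEuclideanLin B⁻¹ y) := by
    rw [← inner_weighted_inv, ← hC, hx]
  have hre : (inner ℂ y x).re = (1 - s) * (inner ℂ y (Matrix.toEuclideanLin A⁻¹ y)).re +
      s * (inner ℂ y (Matrix.toEuclideanLin B⁻¹ y)).re := by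
    rw [hyx, Complex.add_re, Complex.re_ofReal_mul, Complex.re_ofReal_mul]
  have him : (inner ℂ y x).im = (1 - s) * (inner ℂ y (Matrix.toEuclideanLin A⁻¹ y)).im +
      s * (inner ℂ y (Matrix.toEuclideanLin B⁻¹ y)).im := by
    rw [hyx, Complex.add_im, Complex.im_ofReal_mul, Complex.im_ofReal_mul]
  have hsec : |(inner ℂ y x).im| ≤ Real.tan α * (inner ℂ y x).re := by
    rw [hre, him]
    refine (abs_add_le _ _).trans ?_
    rw [abs_mul, abs_mul, abs_of_nonneg hs1, abs_of_nonneg hs.1]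
    have h1 := mul_le_mul_of_nonneg_left (abs_im_inner_inv_le hA hAα y) hs1
    have h2 := mul_le_mul_of_nonneg_left (abs_im_inner_inv_le hB hBα y) hs.1
    linarith
  set K := 1 / Real.cos α with hK
  have hK0 : 0 < K := by positivity
  set c := (1 - s) * (numericalRadius A)⁻¹ + s * (numericalRadius B)⁻¹ with hc
  have hc0 : 0 < c := by
    rcases hs.1.eq_or_lt with h | h
    · rw [hc, ← h]; simpa using ha
    · positivity
  have hlow : c * ‖y‖ ^ 2 ≤ K ^ 2 * (inner ℂ y x).re := by
    have h1 := mul_le_mul_of_nonneg_left (norm_sq_le_re_inner_inv hA hα0 hα1 hAα y) hs1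
    have h2 := mul_le_mul_of_nonneg_left (norm_sq_le_re_inner_inv hB hα0 hα1 hBα y) hs.1
    rw [hre]
    linarith
  have hr0 : 0 ≤ (inner ℂ y x).re :=
    nonneg_of_mul_nonneg_right ((by positivity : 0 ≤ c * ‖y‖ ^ 2).trans hlow) (by positivity)
  have hcs : (inner ℂ y x).re ≤ ‖y‖ * ‖x‖ :=
    (Complex.re_le_norm _).trans (norm_inner_le_norm y x)
  have hup : (inner ℂ y x).re ≤ K ^ 2 * c⁻¹ * ‖x‖ ^ 2 := by
    rcases hr0.eq_or_lt with h | h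
    · rw [← h]; positivity
    -- For `r = Re⟨y,x⟩ > 0`: `r² ≤ ‖y‖²‖x‖² ≤ K²c⁻¹ r ‖x‖²`, then divide by `r`.
    · have h3 : (inner ℂ y x).re ^ 2 ≤ ‖y‖ ^ 2 * ‖x‖ ^ 2 := by
        rw [← mul_pow]; exact pow_le_pow_left₀ hr0 hcs 2
      have h4 : ‖y‖ ^ 2 ≤ K ^ 2 * c⁻¹ * (inner ℂ y x).re := by
        calc ‖y‖ ^ 2 = c⁻¹ * (c * ‖y‖ ^ 2) := by field_simp
          _ ≤ c⁻¹ * (K ^ 2 * (inner ℂ y x).re) :=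
            mul_le_mul_of_nonneg_left hlow (by positivity)
          _ = _ := by ring
      have h5 := mul_le_mul_of_nonneg_right h4 (sq_nonneg ‖x‖)
      refine le_of_mul_le_mul_right ?_ h
      linarith
  calc ‖inner ℂ y x‖ ≤ K * (inner ℂ y x).re := norm_le_sec_mul_re hcos hr0 hsec
    _ ≤ K * (K ^ 2 * c⁻¹ * ‖x‖ ^ 2) := mul_le_mul_of_nonneg_left hup hK0.le
    _ = _ := by ring

end HarmonicMean

/-! ### Integrability, and measurability in the parameter `t` -/

open MeasureTheory

theorem integrable_of_continuousOn_Icc {F : Type*} [NormedAddCommGroup F]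
    {ν : Measure ℝ} [IsFiniteMeasure ν] (hν : ∀ᵐ s ∂ν, s ∈ Set.Icc (0 : ℝ) 1) {f : ℝ → F}
    (hf : ContinuousOn f (Set.Icc 0 1)) : Integrable f ν := by
  rw [← Measure.restrict_eq_self_of_ae_mem hν]
  exact hf.integrableOn_compact isCompact_Icc

/-- Moves the `t`-dependence from the measure into the integrand, so that measurability in `t` can
be read off a fixed product measure. -/
theorem integral_betaMeasure_eq_setIntegral {F : Type*} [NormedAddCommGroup F] [NormedSpace ℝ F]
    {a b : ℝ} (ha : 0 < a) (hb : 0 < b) (g : ℝ → F) :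
    ∫ s, g s ∂(ProbabilityTheory.betaMeasure a b)
      = ∫ s in Set.Ioo (0 : ℝ) 1, ProbabilityTheory.betaPDFReal a b s • g s := by
  have h0 : ∀ s, 0 ≤ ProbabilityTheory.betaPDFReal a b s := by
    intro s
    by_cases h : 0 < s ∧ s < 1
    · exact (ProbabilityTheory.betaPDFReal_pos h.1 h.2 ha hb).le
    · simp [ProbabilityTheory.betaPDFReal, h]
  unfold ProbabilityTheory.betaMeasure
  rw [integral_withDensity_eq_integral_toReal_smul
    (by unfold ProbabilityTheory.betaPDF; fun_prop)
    (Filter.Eventually.of_forall fun s => by simp [ProbabilityTheory.betaPDF])]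
  rw [setIntegral_eq_integral_of_forall_compl_eq_zero]
  · refine integral_congr_ae (Filter.Eventually.of_forall fun s => ?_)
    simp [ProbabilityTheory.betaPDF, ENNReal.toReal_ofReal (h0 s)]
  · intro s hs
    have : ¬ (0 < s ∧ s < 1) := hs
    simp [ProbabilityTheory.betaPDFReal, this]

theorem continuousOn_betaPDFReal :
    ContinuousOn (fun p : ℝ × ℝ => ProbabilityTheory.betaPDFReal p.1 (1 - p.1) p.2)
      (Set.Ioo 0 1 ×ˢ Set.Ioo 0 1) := by
  have hΓ : ∀ s : ℝ, 0 < s → ContinuousAt Real.Gamma s := fun s hs =>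
    (Real.differentiableAt_Gamma fun m h => by
      have : (0 : ℝ) ≤ m := m.cast_nonneg
      linarith).continuousAt
  have : ContinuousOn (fun p : ℝ × ℝ => 1 / ProbabilityTheory.beta p.1 (1 - p.1) *
      p.2 ^ (p.1 - 1) * (1 - p.2) ^ (1 - p.1 - 1)) (Set.Ioo 0 1 ×ˢ Set.Ioo 0 1) := by
    rintro ⟨t, s⟩ ⟨⟨ht0, ht1⟩, ⟨hs0, hs1⟩⟩
    refine ContinuousAt.continuousWithinAt ?_
    simp only at ht0 ht1 hs0 hs1
    have ht1' : 0 < 1 - t := by linarith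
    have hs1' : 1 - s ≠ 0 := by linarith
    have h1 : ContinuousAt (fun p : ℝ × ℝ => Real.Gamma p.1) (t, s) :=
      ContinuousAt.comp (x := (t, s)) (g := Real.Gamma) (f := fun p : ℝ × ℝ => p.1) (hΓ t ht0) (by fun_prop)
    have h2 : ContinuousAt (fun p : ℝ × ℝ => Real.Gamma (1 - p.1)) (t, s) :=
      ContinuousAt.comp (x := (t, s)) (g := Real.Gamma) 
        (f := fun p : ℝ × ℝ => 1 - p.1) (hΓ (1 - t) ht1') (by fun_prop)
    have h3 : ContinuousAt (fun p : ℝ × ℝ => ProbabilityTheory.beta p.1 (1 - p.1)) (t, s) := by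
      simp only [ProbabilityTheory.beta, add_sub_cancel, Real.Gamma_one, div_one]
      exact h1.mul h2
    have h4 : ProbabilityTheory.beta t (1 - t) ≠ 0 :=
      (ProbabilityTheory.beta_pos ht0 ht1').ne'
    refine ((continuousAt_const.div h3 h4).mul ?_).mul ?_
    · exact ContinuousAt.rpow (by fun_prop) (by fun_prop) (Or.inl hs0.ne')
    · exact ContinuousAt.rpow (by fun_prop) (by fun_prop) (Or.inl hs1')
  refine this.congr fun p hp => ?_
  exact if_pos hp.2

theorem setIntegral_betaPDFReal_aestronglyMeasurable {F : Type*} [NormedAddCommGroup F]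
    [NormedSpace ℝ F] {g : ℝ → F} (hg : ContinuousOn g (Set.Ioo 0 1)) :
    AEStronglyMeasurable (fun t => ∫ s in Set.Ioo (0 : ℝ) 1,
      ProbabilityTheory.betaPDFReal t (1 - t) s • g s)
      (volume.restrict (Set.Ioo (0 : ℝ) 1)) := by
  have h : AEStronglyMeasurable
      (fun p : ℝ × ℝ => ProbabilityTheory.betaPDFReal p.1 (1 - p.1) p.2 • g p.2)
      ((volume.restrict (Set.Ioo (0 : ℝ) 1)).prod (volume.restrict (Set.Ioo (0 : ℝ) 1))) := by
    rw [Measure.prod_restrict]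
    refine ContinuousOn.aestronglyMeasurable ?_ (measurableSet_Ioo.prod measurableSet_Ioo)
    exact continuousOn_betaPDFReal.smul (hg.comp continuousOn_snd fun p hp => hp.2)
  exact h.integral_prod_right'

/-! ### Geometric and logarithmic means -/

section MatrixMeans

variable {n : ℕ} {A B : Matrix (Fin n) (Fin n) ℂ}

theorem integrable_harmonicMean (hA : IsAccretive A) (hB : IsAccretive B) {f : ℝ → ℝ}
    {ν : Measure ℝ} (hν : IsMeanMeasure f ν) :
    Integrable (fun s => harmonicMean s A B) ν := by
  have := hν.1
  exact integrable_of_continuousOn_Icc hν.2.1 (continuousOn_harmonicMean hA hB)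

/-- The harmonic means are bounded on the compact interval, and averaging against a probability
measure keeps the bound. Independence of `ν` makes it uniform in `t`. -/
theorem exists_norm_operatorMean_le (hA : IsAccretive A) (hB : IsAccretive B) :
    ∃ M : ℝ, ∀ (f : ℝ → ℝ) (ν : Measure ℝ), IsMeanMeasure f ν →
      ‖operatorMean ν A B‖ ≤ M := by
  obtain ⟨M, hM⟩ := isCompact_Icc.exists_bound_of_continuousOn (continuousOn_harmonicMean hA hB)
  refine ⟨M, fun f ν hν => ?_⟩
  have := hν.1
  refine (norm_integral_le_of_norm_le_const (C := M) ?_).trans (by simp)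
  filter_upwards [hν.2.1] with s hs using hM s hs

theorem intervalIntegrable_geometricMean (hA : IsAccretive A) (hB : IsAccretive B) :
    IntervalIntegrable (fun t => geometricMean t A B) volume 0 1 := by
  -- The endpoints, where the measure is Dirac rather than beta, are null.
  rw [intervalIntegrable_iff_integrableOn_Ioo_of_le zero_le_one]
  obtain ⟨M, hM⟩ := exists_norm_operatorMean_le hA hB
  refine IntegrableOn.of_bound (by simp) ?_ M ?_
  · refine (setIntegral_betaPDFReal_aestronglyMeasurable
      ((continuousOn_harmonicMean hA hB).mono Set.Ioo_subset_Icc_self)).congr ?_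
    filter_upwards [ae_restrict_mem measurableSet_Ioo] with t ht
    rw [geometricMean, geometricMeasure, if_neg ht.1.ne', if_neg ht.2.ne, operatorMean,
      integral_betaMeasure_eq_setIntegral ht.1 (by linarith [ht.2])]
  · filter_upwards [ae_restrict_mem measurableSet_Ioo] with t ht
    exact hM _ _ (isMeanMeasure_geometricMeasure t (Set.Ioo_subset_Icc_self ht))

/-- The quadratic form `A ↦ ⟨Ax, x⟩` as a continuous linear functional of `A`. -/
noncomputable def quadraticFormCLM (x : EuclideanSpace ℂ (Fin n)) :
    Matrix (Fin n) (Fin n) ℂ →L[ℂ] ℂ :=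
  LinearMap.toContinuousLinearMap
    ((innerSL ℂ x : EuclideanSpace ℂ (Fin n) →ₗ[ℂ] ℂ) ∘ₗ (LinearMap.applyₗ x) ∘ₗ
      (Matrix.toEuclideanLin : Matrix (Fin n) (Fin n) ℂ ≃ₗ[ℂ] _).toLinearMap)

theorem quadraticFormCLM_apply (x : EuclideanSpace ℂ (Fin n)) (A : Matrix (Fin n) (Fin n) ℂ) :
    quadraticFormCLM x A = inner ℂ x (Matrix.toEuclideanLin A x) := rfl

/-- Homogeneity reduces the two-variable mean to the integral representation of `x ^ t` at `x = b /
a`. -/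
theorem weighted_inv_eq {a b : ℝ} (ha : 0 < a) (s : ℝ) :
    ((1 - s) * a⁻¹ + s * b⁻¹)⁻¹ = a * ((1 - s) + s * (b / a)⁻¹)⁻¹ := by
  rw [show (1 - s) * a⁻¹ + s * b⁻¹ = a⁻¹ * ((1 - s) + s * (b / a)⁻¹) by
    rw [inv_div]; field_simp, mul_inv, inv_inv]

theorem integrable_weighted_inv {f : ℝ → ℝ} {ν : Measure ℝ} (hν : IsMeanMeasure f ν)
    {a b : ℝ} (ha : 0 < a) (hb : 0 < b) :
    Integrable (fun s => ((1 - s) * a⁻¹ + s * b⁻¹)⁻¹) ν := by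
  have := hν.1
  refine integrable_of_continuousOn_Icc hν.2.1 (ContinuousOn.inv₀ (by fun_prop) ?_)
  intro s hs
  have h1 : 0 ≤ 1 - s := by linarith [hs.2]
  rcases hs.1.eq_or_lt with rfl | h
  · simpa using ha.ne'
  · positivity

theorem integral_weighted_inv_geometricMeasure {t : ℝ} (ht : t ∈ Set.Icc (0 : ℝ) 1)
    {a b : ℝ} (ha : 0 < a) (hb : 0 < b) :
    ∫ s, ((1 - s) * a⁻¹ + s * b⁻¹)⁻¹ ∂(geometricMeasure t) = a ^ (1 - t) * b ^ t := by
  simp_rw [weighted_inv_eq ha]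
  have h : (b / a) ^ t = _ := (isMeanMeasure_geometricMeasure t ht).2.2 (b / a) (by positivity)
  rw [integral_const_mul, ← h,
    Real.div_rpow hb.le ha.le, Real.rpow_sub ha, Real.rpow_one]
  ring

variable [NeZero n] {α : ℝ}

theorem norm_inner_geometricMean_le (hA : IsAccretive A) (hB : IsAccretive B)
    (hα0 : 0 ≤ α) (hα1 : α < Real.pi / 2)
    (hAα : numericalRange A ⊆ sector α) (hBα : numericalRange B ⊆ sector α)
    {t : ℝ} (ht : t ∈ Set.Icc (0 : ℝ) 1) {x : EuclideanSpace ℂ (Fin n)} (hx : ‖x‖ = 1) :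
    ‖inner ℂ x (Matrix.toEuclideanLin (geometricMean t A B) x)‖ ≤ (1 / Real.cos α) ^ 3 *
      (numericalRadius A ^ (1 - t) * numericalRadius B ^ t) := by
  have hν := isMeanMeasure_geometricMeasure t ht
  rw [← integral_weighted_inv_geometricMeasure ht hA.numericalRadius_pos hB.numericalRadius_pos,
    ← quadraticFormCLM_apply, geometricMean, operatorMean,
    ← ContinuousLinearMap.integral_comp_comm _ (integrable_harmonicMean hA hB hν),
    ← integral_const_mul]
  refine norm_integral_le_of_norm_le ((integrable_weighted_inv hν hA.numericalRadius_pos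
    hB.numericalRadius_pos).const_mul _) ?_
  filter_upwards [hν.2.1] with s hs
  have := norm_inner_harmonicMean_le hA hB hα0 hα1 hAα hBα hs x
  rwa [hx, one_pow, mul_one] at this

theorem norm_inner_logarithmicMean_le (hA : IsAccretive A) (hB : IsAccretive B)
    (hα0 : 0 ≤ α) (hα1 : α < Real.pi / 2)
    (hAα : numericalRange A ⊆ sector α) (hBα : numericalRange B ⊆ sector α)
    {x : EuclideanSpace ℂ (Fin n)} (hx : ‖x‖ = 1) :
    ‖inner ℂ x (Matrix.toEuclideanLin (logarithmicMean A B) x)‖ ≤ (1 / Real.cos α) ^ 3 *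
      scalarLogarithmicMean (numericalRadius A) (numericalRadius B) := by
  have ha := hA.numericalRadius_pos.ne'
  have hb := hB.numericalRadius_pos.ne'
  rw [← quadraticFormCLM_apply, logarithmicMean, scalarLogarithmicMean,
    ← ContinuousLinearMap.intervalIntegral_comp_comm _ (intervalIntegrable_geometricMean hA hB),
    ← intervalIntegral.integral_const_mul]
  refine intervalIntegral.norm_integral_le_of_norm_le zero_le_one ?_ ?_
  · refine Filter.Eventually.of_forall fun t ht => ?_
    exact norm_inner_geometricMean_le hA hB hα0 hα1 hAα hBα (Set.Ioc_subset_Icc_self ht) hx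
  · refine Continuous.intervalIntegrable ?_ _ _
    refine continuous_const.mul (Continuous.mul ?_ ?_)
    · exact continuous_const.rpow (by fun_prop) fun _ => Or.inl ha
    · exact continuous_const.rpow (by fun_prop) fun _ => Or.inl hb

end MatrixMeans

theorem scalarLogarithmicMean_nonneg {a b : ℝ} (ha : 0 ≤ a) (hb : 0 ≤ b) :
    0 ≤ scalarLogarithmicMean a b :=
  intervalIntegral.integral_nonneg zero_le_one fun t _ => by positivity

theorem numericalRadius_nonneg {n : ℕ} (A : Matrix (Fin n) (Fin n) ℂ) :
    0 ≤ numericalRadius A :=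
  Real.sSup_nonneg fun _ ⟨_, _, h⟩ => h ▸ norm_nonneg _

end NumRadius

theorem mainTheorem10 {n : ℕ} (α : ℝ) (hα0 : 0 ≤ α) (hα1 : α < Real.pi / 2)
    (A B : Matrix (Fin n) (Fin n) ℂ)
    (hA : NumRadius.IsAccretive A) (hB : NumRadius.IsAccretive B)
    (hAα : NumRadius.numericalRange A ⊆ NumRadius.sector α)
    (hBα : NumRadius.numericalRange B ⊆ NumRadius.sector α) :
    (∀ t ∈ Set.Icc (0 : ℝ) 1, MeasureTheory.Integrable
      (fun s => NumRadius.harmonicMean s A B) (NumRadius.geometricMeasure t)) ∧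
    IntervalIntegrable (fun t => NumRadius.geometricMean t A B) MeasureTheory.volume 0 1 ∧
    NumRadius.numericalRadius (NumRadius.logarithmicMean A B) ≤
      (1 / Real.cos α) ^ 3 *
        NumRadius.scalarLogarithmicMean
          (NumRadius.numericalRadius A) (NumRadius.numericalRadius B) := by
  refine ⟨fun t ht => NumRadius.integrable_harmonicMean hA hB
    (NumRadius.isMeanMeasure_geometricMeasure t ht),
    NumRadius.intervalIntegrable_geometricMean hA hB, ?_⟩
  have hcos : 0 < Real.cos α := Real.cos_pos_of_mem_Ioo ⟨by linarith [Real.pi_pos], hα1⟩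
  refine NumRadius.numericalRadius_le (mul_nonneg (by positivity)
    (NumRadius.scalarLogarithmicMean_nonneg (NumRadius.numericalRadius_nonneg A)
      (NumRadius.numericalRadius_nonneg B))) fun x hx => ?_
  -- A unit vector exists only in positive dimension; this makes the numerical radii strictly
  -- positive.
  have : NeZero n := ⟨by
    rintro rfl
    simp [Subsingleton.elim x 0] at hx⟩
  exact NumRadius.norm_inner_logarithmicMean_le hA hB hα0 hα1 hAα hBα hx
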